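/- Let $\Gamma=\langle S,(A(s))_{s\in S},(B(s))_{s\in S},q,r\rangle$ be a zero-sum two-person stochastic game with a finite non-empty state space $S$ and finite non-empty sets $A(s)$, $B(s)$ of admissible actions of player I (the maximiser) and player II (the minimiser) in each state $s$. Here $q(\cdot\mid s,i,j)$ is a probability distribution on $S$ (the law of the next state) and $r(s,i,j)\in\mathbb R$ is the immediate reward of player I, for $s\in S$, $i\in A(s)$, $j\in B(s)$. Assume that $\Gamma$ has perfect information: $S$ is the disjoint union of two sets $S_1,S_2$ such that $|B(s)|=1$ for all $s\in S_1$ and $|A(s)|=1$ for all $s\in S_2$. A behavioural strategy of player I (respectively II) assigns to every decision epoch $n=0,1,2,\dots$ and every history $(s_0,a_0,b_0,\dots,s_{n-1},a_{n-1},b_{n-1},s_n)$ a probability distribution on $A(s_n)$ (respectively $B(s_n)$); let $\Pi_1$, $\Pi_2$ be the sets of these strategies. At every epoch the two players randomise independently of each other given the history. A pure stationary strategy is one that, at every epoch and after every history, chooses with probability one an action that depends only on the present state. For $s\in S$ and $(\pi_1,\pi_2)\in\Pi_1\times\Pi_2$ let $$\phi(s,\pi_1,\pi_2)=\liminf_{n\to\infty}\frac1n\,E_{\pi_1\pi_2}\Big[\sum_{m=0}^{n-1}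 r(s_m,a_m,b_m)\,\Big|\,s_0=s\Big].$$ Then $\Gamma$ has a value vector and an optimal pair of pure stationary strategies. That is, there are $\phi:S\to\mathbb R$ with $$\sup_{\pi_1\in\Pi_1}\inf_{\pi_2\in\Pi_2}\phi(s,\pi_1,\pi_2)=\phi(s)=\inf_{\pi_2\in\Pi_2}\sup_{\pi_1\in\Pi_1}\phi(s,\pi_1,\pi_2)\qquad\text{for all } s\in S,$$ and pure stationary strategies $f^*$ of player I and $g^*$ of player II such that $$\phi(s,f^*,\pi_2)\ \ge\ \phi(s)\ \ge\ \phi(s,\pi_1,g^*)\qquad\text{for all } s\in S,\ \pi_1\in\Pi_1,\ \pi_2\in\Pi_2.$$ -/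

import Mathlib

noncomputable section

universe u v w x

/-- A zero-sum two-person (non-stopping) stochastic game with state space `S` and admissible action
sets `A s` (player I, the maximiser) and `B s` (player II, the minimiser) in state `s`.
* `q s i j` is the probability distribution of the next state, given that in state `s` the players
  choose the actions `i` and `j`;
* `r s i j` is the immediate reward of player I (and `-r s i j` that of player II). -/
structure StochasticGame (S : Type u) (A : S → Type v) (B : S → Type w) where
  q : (s : S) → A s → B s → PMF S
  r : (s : S) → A s → B s → ℝ

namespace StochasticGame

open MeasureTheory ProbabilityTheory Filter

variable {S : Type u} {A : S → Type v} {B : S → Type w}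

/-- Perfect information: the states split into a set `S₁` on which player II has only one action
and a set `S₂` on which player I has only one action. -/
def PerfectInformation (_G : StochasticGame S A B) : Prop :=
  ∃ S₁ S₂ : Set S, S₁ ∪ S₂ = Set.univ ∧ S₁ ∩ S₂ = ∅ ∧
    (∀ s ∈ S₁, Nat.card (B s) = 1) ∧ (∀ s ∈ S₂, Nat.card (A s) = 1)

variable (A B) in
/-- The admissible triplets `(s, i, j)` with `i ∈ A s` and `j ∈ B s`: what happens at one decision
epoch. -/
def Triplet : Type (max u v w) := Σ s : S, A s × B s

instance : MeasurableSpace (Triplet A B) := ⊤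

instance [Finite S] [∀ s, Finite (A s)] [∀ s, Finite (B s)] : Finite (Triplet A B) :=
  inferInstanceAs (Finite (Σ s : S, A s × B s))

variable (A B) in
/-- A behavioural strategy for a player whose admissible action sets are `C s` (`C = A` for
player I, `C = B` for player II). At each decision epoch `n = 0, 1, 2, …` it associates with the
history, i.e. the triplets `(s₀, a₀, b₀), …, (sₙ₋₁, aₙ₋₁, bₙ₋₁)` and the present state `sₙ`, a
probability distribution on `C sₙ`. -/
def Strategy (C : S → Type x) : Type (max u v w x) :=
  (n : ℕ) → (Fin n → Triplet A B) → (s : S) → PMF (C s)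

/-- The stationary strategy given by `f`: whatever the epoch and the past, choose the action in the
present state `s` according to `f s`. -/
def stationary {C : S → Type x} (f : (s : S) → PMF (C s)) : Strategy A B C :=
  fun _ _ s => f s

/-- The pure stationary strategy given by `f`: in state `s` choose action `f s` with
probability one. -/
def pureStationary {C : S → Type x} (f : (s : S) → C s) : Strategy A B C :=
  stationary fun s => PMF.pure (f s)

/-- The law of the triplet at epoch `n` given the past `h` and the present state `s`: the players
choose their actions independently of each other, according to `π₁` and `π₂`. -/
def tripletLaw (π₁ : Strategy A B A) (π₂ : Strategy A B B) (n : ℕ) (h : Fin n → Triplet A B)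
    (s : S) : PMF (Triplet A B) :=
  (π₁ n h s).bind fun i => (π₂ n h s).bind fun j => PMF.pure ⟨s, i, j⟩

/-- The law of the triplet at epoch `n + 1` given the triplets at the epochs `0, …, n`: the game
moves from `(sₙ, iₙ, jₙ)` to a state drawn from `q sₙ iₙ jₙ`, where the players choose actions. -/
def nextLaw (G : StochasticGame S A B) (π₁ : Strategy A B A) (π₂ : Strategy A B B) (n : ℕ)
    (h : Fin (n + 1) → Triplet A B) : PMF (Triplet A B) :=
  (G.q (h (Fin.last n)).1 (h (Fin.last n)).2.1 (h (Fin.last n)).2.2).bind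
    (tripletLaw π₁ π₂ (n + 1) h)

section Finite

variable [Finite S] [∀ s, Finite (A s)] [∀ s, Finite (B s)]

/-- `nextLaw` as a Markov kernel. -/
def nextKernel (G : StochasticGame S A B) (π₁ : Strategy A B A) (π₂ : Strategy A B B) (n : ℕ) :
    Kernel ((i : Finset.Iic n) → (fun _ : ℕ => Triplet A B) i) (Triplet A B) where
  toFun h := (G.nextLaw π₁ π₂ n
    fun k => h ⟨k, Finset.mem_Iic.2 (Nat.lt_succ_iff.1 k.2)⟩).toMeasure
  measurable' := measurable_of_countable _

instance (G : StochasticGame S A B) (π₁ : Strategy A B A) (π₂ : Strategy A B B) (n : ℕ) :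
    IsMarkovKernel (G.nextKernel π₁ π₂ n) :=
  ⟨fun h => PMF.toMeasure.isProbabilityMeasure (G.nextLaw π₁ π₂ n
    fun k => h ⟨k, Finset.mem_Iic.2 (Nat.lt_succ_iff.1 k.2)⟩)⟩

/-- The probability measure on the space of infinite plays `(s₀, a₀, b₀), (s₁, a₁, b₁), …` that is
induced by the strategies `π₁`, `π₂` and the initial state `s₀ = s`. -/
def playMeasure (G : StochasticGame S A B) (s : S) (π₁ : Strategy A B A) (π₂ : Strategy A B B) :
    Measure (ℕ → Triplet A B) :=
  Kernel.trajMeasure (X := fun _ => Triplet A B)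
    (tripletLaw π₁ π₂ 0 Fin.elim0 s).toMeasure (G.nextKernel π₁ π₂)

/-- The limiting average (undiscounted) payoff to player I from the initial state `s`: the lower
limit, as `n → ∞`, of `1 / n` times the expected total reward over the first `n` epochs. -/
def payoff (G : StochasticGame S A B) (s : S) (π₁ : Strategy A B A) (π₂ : Strategy A B B) :
    EReal :=
  liminf (fun n : ℕ => (((1 / (n : ℝ)) * ∫ ω, ∑ m ∈ Finset.range n,
    G.r (ω m).1 (ω m).2.1 (ω m).2.2 ∂(G.playMeasure s π₁ π₂) : ℝ) : EReal)) atTop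

/-- `φ` is the value vector of the game:
`sup_{π₁} inf_{π₂} φ(s, π₁, π₂) = φ(s) = inf_{π₂} sup_{π₁} φ(s, π₁, π₂)` for every state `s`. -/
def IsValueVector (G : StochasticGame S A B) (φ : S → ℝ) : Prop :=
  ∀ s, (⨆ π₁ : Strategy A B A, ⨅ π₂ : Strategy A B B, G.payoff s π₁ π₂) = (φ s : EReal) ∧
    (⨅ π₂ : Strategy A B B, ⨆ π₁ : Strategy A B A, G.payoff s π₁ π₂) = (φ s : EReal)

/-- `(σ₁, σ₂)` is an optimal strategy pair in the game with value vector `φ`: for every initial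
state, `σ₁` guarantees player I at least `φ s` against every behavioural strategy of player II, and
`σ₂` holds player I down to at most `φ s` against every behavioural strategy of player I. -/
def IsOptimalPair (G : StochasticGame S A B) (φ : S → ℝ) (σ₁ : Strategy A B A)
    (σ₂ : Strategy A B B) : Prop :=
  ∀ s, (∀ π₂ : Strategy A B B, (φ s : EReal) ≤ G.payoff s σ₁ π₂) ∧
    (∀ π₁ : Strategy A B A, G.payoff s π₁ σ₂ ≤ (φ s : EReal))

end Finite

end StochasticGame

end

/-!
The proof goes through the discounted games, for discount factors `β` tending to one.

In a game with perfect information the auxiliary matrix games of Shapley's operator have only one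
row or only one column, hence pure saddle points, so every `β`-discounted game has a value `v` and
optimal pure stationary strategies (`PerfectInformation.exists_isDiscountedSolution`). There are
finitely many pairs of such strategies, so one pair `(f, g)` is optimal for discount factors
arbitrarily close to one. For these `β` the value solves `v = r + β P v` with the fixed stochastic
operator `P` of `(f, g)`, and therefore `v = φ / (1 - β) + w + O(1 - β)` with `P φ = φ`
(`exists_fixed_add_range`, `norm_sub_expansion_le`).

Inserting the expansion into the optimality inequalities of the discounted game and letting `β`
tend to one (`average_le_of_frequently_discounted_le`) shows that, against `f`, every action of
player II satisfies `φ s ≤ ∑ₜ q t * φ t`, and where equality holds also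
`φ s + w s ≤ r + ∑ₜ q t * w t`. Since there are finitely many actions, the second inequality holds
everywhere once `w` is replaced by `H = w + M φ` with `M` large. Along any play in which player I
uses `f`, the expectation of `φ` thus does not decrease and the terms in `H` telescope, so that the
expected total reward of `n` epochs is at least `n φ s - 2 ‖H‖`, whatever behavioural strategy
player II uses (`le_integral_sum`). The same argument with all signs reversed bounds the payoff
against `g` from above. The bounds hold for every `n`, so no Tauberian theorem is needed to deal
with the lower limit in the payoff.
-/

namespace StochasticGame

open MeasureTheory ProbabilityTheory Filter Topology

/-! ### Mean values -/

section Mean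

variable {S : Type*} [Fintype S]

/-- The expectation of `v` under `p`, as a linear functional of `v`. -/
noncomputable def mean (p : PMF S) : (S → ℝ) →ₗ[ℝ] ℝ where
  toFun v := ∑ t, (p t).toReal * v t
  map_add' v w := by simp [mul_add, Finset.sum_add_distrib]
  map_smul' c v := by
    simp only [Pi.smul_apply, smul_eq_mul, RingHom.id_apply, Finset.mul_sum]
    exact Finset.sum_congr rfl fun _ _ => by ring

theorem mean_apply (p : PMF S) (v : S → ℝ) : mean p v = ∑ t, (p t).toReal * v t := rfl

theorem mean_const (p : PMF S) (c : ℝ) : mean p (fun _ => c) = c := by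
  have h : ∑ t, (p t).toReal = 1 := by
    rw [← ENNReal.toReal_sum fun t _ => p.apply_ne_top t, ← tsum_fintype (L := .unconditional S),
      p.tsum_coe, ENNReal.toReal_one]
  rw [mean_apply, ← Finset.sum_mul, h, one_mul]

theorem mean_mono (p : PMF S) {v w : S → ℝ} (h : ∀ t, v t ≤ w t) : mean p v ≤ mean p w :=
  Finset.sum_le_sum fun t _ => mul_le_mul_of_nonneg_left (h t) ENNReal.toReal_nonneg

theorem abs_mean_le (p : PMF S) (v : S → ℝ) : |mean p v| ≤ ‖v‖ := by
  have h : ∀ t, |v t| ≤ ‖v‖ := norm_le_pi_norm v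
  refine abs_le.2 ⟨?_, ?_⟩
  · simpa [mean_const] using mean_mono p (v := fun _ => -‖v‖) fun t => (abs_le.1 (h t)).1
  · simpa [mean_const] using mean_mono p (w := fun _ => ‖v‖) fun t => (abs_le.1 (h t)).2

theorem integral_toMeasure_eq_mean [MeasurableSpace S] [MeasurableSingletonClass S]
    (p : PMF S) (v : S → ℝ) : ∫ t, v t ∂p.toMeasure = mean p v := by
  simp [PMF.integral_eq_sum, mean_apply]

end Mean

/-! ### Resolvent of a nonexpansive operator near one -/

section Resolvent

variable {E : Type*} [NormedAddCommGroup E] [NormedSpace ℝ E]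

/-- For a nonexpansive operator `P` the space is the direct sum of the fixed space of `P` and the
range of `1 - P`. The component in the range is the image of a vector which may itself be taken
in that range. -/
theorem exists_fixed_add_range [FiniteDimensional ℝ E] (P : E →ₗ[ℝ] E) (hP : ∀ v, ‖P v‖ ≤ ‖v‖)
    (r : E) : ∃ φ y : E, P φ = φ ∧ r = φ + ((y - P y) - P (y - P y)) := by
  let Q : E →ₗ[ℝ] E := LinearMap.id - P
  have hdisj : Disjoint (LinearMap.ker Q) (LinearMap.range Q) := by
    rw [Submodule.disjoint_def]
    rintro x hx ⟨y, rfl⟩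
    set x := Q y with hxdef
    have hPx : P x = x := (sub_eq_zero.1 (by simpa [Q] using hx)).symm
    have hPy : P y = y - x := by simp [hxdef, Q]
    -- The orbit `Pⁿ y = y - n x` is bounded, which forces `x = 0`.
    have hn : ∀ n : ℕ, ‖y - (n : ℝ) • x‖ ≤ ‖y‖ := by
      intro n
      induction n with
      | zero => simp
      | succ n ih =>
        have : P (y - (n : ℝ) • x) = y - ((n + 1 : ℕ) : ℝ) • x := by
          rw [map_sub, map_smul, hPx, hPy]; push_cast; module
        exact this ▸ (hP _).trans ih
    have hb : ∀ n : ℕ, (n : ℝ) * ‖x‖ ≤ 2 * ‖y‖ := fun n => by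
      have h1 : ‖(n : ℝ) • x‖ = n * ‖x‖ := by rw [norm_smul]; simp
      have h2 : ‖(n : ℝ) • x‖ ≤ ‖y‖ + ‖y - (n : ℝ) • x‖ := by
        simpa using norm_sub_le y (y - (n : ℝ) • x)
      linarith [hn n]
    by_contra hx0
    have hpos : 0 < ‖x‖ := norm_pos_iff.2 hx0
    obtain ⟨n, hn'⟩ := exists_nat_gt (2 * ‖y‖ / ‖x‖)
    rw [div_lt_iff₀ hpos] at hn'
    linarith [hb n]
  have hcompl : LinearMap.ker Q ⊔ LinearMap.range Q = ⊤ :=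
    ((Submodule.isCompl_iff_disjoint _ _
      (by rw [add_comm, LinearMap.finrank_range_add_finrank_ker])).2 hdisj).sup_eq_top
  have hdec : ∀ z : E, ∃ φ u : E, P φ = φ ∧ z = φ + (u - P u) := fun z => by
    have hz : z ∈ LinearMap.ker Q ⊔ LinearMap.range Q := hcompl ▸ Submodule.mem_top
    obtain ⟨φ, hφ, _, ⟨u, rfl⟩, h⟩ := Submodule.mem_sup.1 hz
    exact ⟨φ, u, (sub_eq_zero.1 (by simpa [Q] using hφ)).symm, by simpa [Q] using h.symm⟩
  obtain ⟨φ, u, hφ, rfl⟩ := hdec r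
  obtain ⟨ψ, y, hψ, rfl⟩ := hdec u
  exact ⟨φ, y, hφ, by simp only [map_add, hψ]; abel⟩

/-- The beginning of the Laurent expansion at `β = 1` of the solution of `v = r + β P v`: a simple
pole with residue the fixed component `φ` of `r`, then the constant term `y - P y`, then an error
of order `1 - β`. -/
theorem norm_sub_expansion_le (P : E →ₗ[ℝ] E) (hP : ∀ v, ‖P v‖ ≤ ‖v‖) {r φ y v : E} {β : ℝ}
    (hβ0 : 0 ≤ β) (hβ1 : β < 1) (hφ : P φ = φ) (hr : r = φ + ((y - P y) - P (y - P y)))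
    (hv : v = r + β • P v) :
    ‖v - ((1 - β)⁻¹ • φ + (y - P y))‖ ≤ (1 - β) * (2 * ‖y‖) := by
  have hε : 0 < 1 - β := sub_pos.2 hβ1
  set d := v - ((1 - β)⁻¹ • φ + (y - P y)) with hd
  -- Adding `(1 - β) P y` to the error leaves a right-hand side of second order in `1 - β`.
  set e := d + (1 - β) • P y with he
  have hee : e = β • P e + (1 - β) ^ 2 • P (P y) := by
    have hc : (1 - β)⁻¹ • φ = φ + (β * (1 - β)⁻¹) • φ := by
      have : (1 - β)⁻¹ = 1 + β * (1 - β)⁻¹ := by field_simp; ring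
      conv_lhs => rw [this]
      module
    have hPd : P e = P v - (1 - β)⁻¹ • φ - P y + P (P y) + (1 - β) • P (P y) := by
      simp only [he, hd, map_add, map_sub, map_smul, hφ]; abel
    have hve : e = r + β • P v - (1 - β)⁻¹ • φ - (y - P y) + (1 - β) • P y := by
      rw [he, hd, ← hv]; abel
    rw [hPd, hve, hc, hr]
    simp only [map_sub]
    have hc' : β • ((β * (1 - β)⁻¹) • φ) = (β * (1 - β)⁻¹) • φ - β • φ := by
      rw [smul_smul, ← sub_smul]; congr 1; field_simp; ring
    simp only [smul_add, smul_sub, hc']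
    module
  have hPP : ‖P (P y)‖ ≤ ‖y‖ := (hP _).trans (hP _)
  have h1 : ‖e‖ ≤ β * ‖e‖ + (1 - β) ^ 2 * ‖y‖ := by
    calc ‖e‖ = ‖β • P e + (1 - β) ^ 2 • P (P y)‖ := by rw [← hee]
      _ ≤ ‖β • P e‖ + ‖(1 - β) ^ 2 • P (P y)‖ := norm_add_le _ _
      _ = β * ‖P e‖ + (1 - β) ^ 2 * ‖P (P y)‖ := by
        rw [norm_smul, norm_smul, Real.norm_of_nonneg hβ0, Real.norm_of_nonneg (sq_nonneg _)]
      _ ≤ _ := by gcongr; exact hP e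
  have h2 : ‖e‖ ≤ (1 - β) * ‖y‖ := by
    refine le_of_mul_le_mul_left ?_ hε
    nlinarith
  have h3 : ‖d‖ ≤ ‖e‖ + (1 - β) * ‖P y‖ := by
    have : d = e - (1 - β) • P y := by rw [he]; abel
    calc ‖d‖ = ‖e - (1 - β) • P y‖ := by rw [← this]
      _ ≤ ‖e‖ + ‖(1 - β) • P y‖ := norm_sub_le _ _
      _ = _ := by rw [norm_smul, Real.norm_of_nonneg hε.le]
  nlinarith [hP y]

end Resolvent

/-! ### Passage to the limit in the discounted inequalities -/

section Vanishing

variable {S : Type*} [Fintype S]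

/-- If `v s ≤ c + β · mean p v` for discount factors `β` arbitrarily close to one, where `v` expands
as `φ / (1 - β) + w + O(1 - β)`, then `φ` is subharmonic at `s` and `w + M φ` satisfies the average
reward inequality at `s` for all large `M`. The multiple of `φ` compensates for a possible failure
of the inequality for `w` where `φ s < mean p φ`. -/
theorem average_le_of_frequently_discounted_le {φ w : S → ℝ} {C c : ℝ} {p : PMF S} {s : S}
    (h : ∃ᶠ β in 𝓝[<] (1 : ℝ), ∃ v : S → ℝ,
      ‖v - ((1 - β)⁻¹ • φ + w)‖ ≤ (1 - β) * C ∧ v s ≤ c + β * mean p v) :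
    φ s ≤ mean p φ ∧ ∀ᶠ M : ℝ in atTop,
      φ s + (w + M • φ) s ≤ c + mean p (w + M • φ) := by
  set a := mean p φ
  set b := mean p w
  -- The inequality multiplied by `1 - β`.
  have key : ∃ᶠ β in 𝓝[<] (1 : ℝ), 0 < 1 - β ∧ φ s + (1 - β) * w s - (1 - β) ^ 2 * C ≤
      (1 - β) * c + β * (a + (1 - β) * b + (1 - β) ^ 2 * C) := by
    have hev : ∀ᶠ β in 𝓝[<] (1 : ℝ), 0 < β ∧ β < 1 :=
      Ioo_mem_nhdsLT one_pos
    refine (h.and_eventually hev).mono ?_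
    rintro β ⟨⟨v, hv, hvs⟩, hβ0, hβ1⟩
    have hε : 0 < 1 - β := sub_pos.2 hβ1
    refine ⟨hε, ?_⟩
    have h1 := (abs_le.1 ((norm_le_pi_norm (v - ((1 - β)⁻¹ • φ + w)) s).trans hv)).1
    have h2 := (abs_le.1 ((abs_mean_le p (v - ((1 - β)⁻¹ • φ + w))).trans hv)).2
    simp only [map_sub, map_add, map_smul, Pi.sub_apply, Pi.add_apply, Pi.smul_apply,
      smul_eq_mul] at h1 h2
    have e1 : (1 - β) * ((1 - β)⁻¹ * φ s) = φ s := mul_inv_cancel_left₀ hε.ne' _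
    have e2 : (1 - β) * ((1 - β)⁻¹ * a) = a := mul_inv_cancel_left₀ hε.ne' _
    have h3 : (1 - β)⁻¹ * φ s + w s - (1 - β) * C ≤
        c + β * ((1 - β)⁻¹ * a + b + (1 - β) * C) := by
      have := mul_le_mul_of_nonneg_left h2 hβ0.le
      linarith
    have h4 := mul_le_mul_of_nonneg_left h3 hε.le
    have e3 : (1 - β) * (c + β * ((1 - β)⁻¹ * a + b + (1 - β) * C)) =
        (1 - β) * c + β * ((1 - β) * ((1 - β)⁻¹ * a) + (1 - β) * b + (1 - β) ^ 2 * C) := by ring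
    rw [e3, e2] at h4
    linarith
  have hlim : ∀ f : ℝ → ℝ, Continuous f → (∃ᶠ β in 𝓝[<] (1 : ℝ), 0 ≤ f β) → 0 ≤ f 1 :=
    fun f hf hfr => ge_of_tendsto_of_frequently (hf.continuousWithinAt.tendsto) hfr
  have hφ : φ s ≤ a := by
    have := hlim (fun β => (1 - β) * c + β * (a + (1 - β) * b + (1 - β) ^ 2 * C) -
      (φ s + (1 - β) * w s - (1 - β) ^ 2 * C)) (by fun_prop)
      (key.mono fun β hβ => sub_nonneg.2 hβ.2)
    simpa using this
  refine ⟨hφ, ?_⟩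
  simp only [map_add, map_smul, Pi.add_apply, Pi.smul_apply, smul_eq_mul]
  rcases hφ.eq_or_lt with heq | hlt
  · have := hlim (fun β => c - a + β * b + β * (1 - β) * C - w s + (1 - β) * C) (by fun_prop)
      (key.mono fun β hβ => by
        refine nonneg_of_mul_nonneg_right ?_ hβ.1
        have := hβ.2
        rw [heq] at this
        linarith)
    refine Eventually.of_forall fun M => ?_
    change φ s + (w s + M * φ s) ≤ c + (b + M * a)
    rw [heq]
    simp at this
    linarith
  · filter_upwards [eventually_ge_atTop ((φ s + w s - c - b) / (a - φ s))] with M hM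
    rw [div_le_iff₀ (sub_pos.2 hlt)] at hM
    change φ s + (w s + M * φ s) ≤ c + (b + M * a)
    linarith

end Vanishing

/-! ### Discounted games -/

section Discounted

variable {S : Type*} {A B : S → Type*}

/-- A matrix game in which one of the players has a single action has a pure saddle point. -/
theorem exists_saddlePoint {α β : Type*} [Finite α] [Finite β] [Nonempty α] [Nonempty β]
    (h : Subsingleton α ∨ Subsingleton β) (L : α → β → ℝ) :
    ∃ i j, (∀ i', L i' j ≤ L i j) ∧ ∀ j', L i j ≤ L i j' := by
  rcases h with h | h
  · obtain ⟨i⟩ := ‹Nonempty α›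
    obtain ⟨j, hj⟩ := Finite.exists_min (L i)
    exact ⟨i, j, fun i' => by rw [Subsingleton.elim i' i], hj⟩
  · obtain ⟨j⟩ := ‹Nonempty β›
    obtain ⟨i, hi⟩ := Finite.exists_max fun i => L i j
    exact ⟨i, j, hi, fun j' => by rw [Subsingleton.elim j' j]⟩

theorem PerfectInformation.subsingleton_or [∀ s, Finite (A s)] [∀ s, Finite (B s)]
    {G : StochasticGame S A B} (hG : G.PerfectInformation) (s : S) :
    Subsingleton (A s) ∨ Subsingleton (B s) := by
  obtain ⟨S₁, S₂, hU, -, hB, hA⟩ := hG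
  rcases (hU ▸ Set.mem_univ s : s ∈ S₁ ∪ S₂) with hs | hs
  · exact Or.inr (Finite.card_le_one_iff_subsingleton.1 (hB s hs).le)
  · exact Or.inl (Finite.card_le_one_iff_subsingleton.1 (hA s hs).le)

variable [Fintype S]

/-- `v` is a value of the `β`-discounted game and `f`, `g` are optimal actions: in each state `s`
the pair `(f s, g s)` is a saddle point, of value `v s`, of the auxiliary matrix game with entries
`r s i j + β ∑ₜ q(t | s, i, j) v t`. -/
structure IsDiscountedSolution (G : StochasticGame S A B) (β : ℝ) (f : ∀ s, A s) (g : ∀ s, B s)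
    (v : S → ℝ) : Prop where
  eq : ∀ s, v s = G.r s (f s) (g s) + β * mean (G.q s (f s) (g s)) v
  le : ∀ s j, v s ≤ G.r s (f s) j + β * mean (G.q s (f s) j) v
  ge : ∀ s i, G.r s i (g s) + β * mean (G.q s i (g s)) v ≤ v s

/-- The value of the discounted game is the fixed point of the Shapley operator, a contraction. -/
theorem PerfectInformation.exists_isDiscountedSolution [∀ s, Finite (A s)] [∀ s, Nonempty (A s)]
    [∀ s, Finite (B s)] [∀ s, Nonempty (B s)] {G : StochasticGame S A B}
    (hG : G.PerfectInformation) {β : ℝ} (hβ0 : 0 ≤ β) (hβ1 : β < 1) :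
    ∃ f g v, G.IsDiscountedSolution β f g v := by
  choose i j hi hj using fun (v : S → ℝ) (s : S) =>
    exists_saddlePoint (hG.subsingleton_or s) fun i j => G.r s i j + β * mean (G.q s i j) v
  let T : (S → ℝ) → S → ℝ := fun v s =>
    G.r s (i v s) (j v s) + β * mean (G.q s (i v s) (j v s)) v
  have hle : ∀ v w s, T v s - T w s ≤ β * ‖v - w‖ := fun v w s => by
    have h1 := hj v s (j w s)
    have h2 := hi w s (i v s)
    have h3 := mul_le_mul_of_nonneg_left
      ((le_abs_self _).trans (abs_mean_le (G.q s (i v s) (j w s)) (v - w))) hβ0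
    rw [map_sub] at h3
    simp only [T]
    linarith
  have hT : ContractingWith ⟨β, hβ0⟩ T := by
    refine ⟨hβ1, LipschitzWith.of_dist_le_mul fun v w => ?_⟩
    change dist (T v) (T w) ≤ β * dist v w
    rw [dist_eq_norm, dist_eq_norm]
    refine (pi_norm_le_iff_of_nonneg (mul_nonneg hβ0 (norm_nonneg _))).2 fun s => ?_
    refine abs_sub_le_iff.2 ⟨hle v w s, ?_⟩
    rw [norm_sub_rev]
    exact hle w v s
  obtain ⟨v, hv⟩ : ∃ v, T v = v := ⟨_, hT.fixedPoint_isFixedPt⟩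
  have hvs : ∀ s, v s = T v s := fun s => congrFun hv.symm s
  exact ⟨i v, j v, v, hvs, fun s b => (hvs s).trans_le (hj v s b),
    fun s a => (hi v s a).trans_eq (hvs s).symm⟩

/-- Certificates of optimality for the limiting average payoff: the common gain vector `φ`
is subharmonic (superharmonic) against every action of player II (player I), and `H₁` (`H₂`) is a
bias vector for the corresponding one-sided average reward inequality. -/
structure IsAverageCertificate (G : StochasticGame S A B) (φ H₁ H₂ : S → ℝ)
    (f : ∀ s, A s) (g : ∀ s, B s) : Prop where
  le_mean : ∀ s j, φ s ≤ mean (G.q s (f s) j) φ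
  le_reward : ∀ s j, φ s + H₁ s ≤ G.r s (f s) j + mean (G.q s (f s) j) H₁
  mean_le : ∀ s i, mean (G.q s i (g s)) φ ≤ φ s
  reward_le : ∀ s i, G.r s i (g s) + mean (G.q s i (g s)) H₂ ≤ φ s + H₂ s

/-- A pair of pure actions that is optimal for discount factors arbitrarily close to one exists by
the pigeonhole principle; the Laurent expansion of its discounted payoff yields a certificate. -/
theorem PerfectInformation.exists_isAverageCertificate [∀ s, Finite (A s)] [∀ s, Nonempty (A s)]
    [∀ s, Finite (B s)] [∀ s, Nonempty (B s)] {G : StochasticGame S A B}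
    (hG : G.PerfectInformation) :
    ∃ φ H₁ H₂ f g, G.IsAverageCertificate φ H₁ H₂ f g := by
  have hev : ∀ᶠ β in 𝓝[<] (1 : ℝ), 0 < β ∧ β < 1 := Ioo_mem_nhdsLT one_pos
  obtain ⟨⟨f, g⟩, hfg⟩ : ∃ fg : (∀ s, A s) × (∀ s, B s), ∃ᶠ β in 𝓝[<] (1 : ℝ),
      (0 < β ∧ β < 1) ∧ ∃ v, G.IsDiscountedSolution β fg.1 fg.2 v := by
    by_contra hcon
    simp only [not_exists, not_frequently] at hcon
    obtain ⟨β, hβ, hβ01⟩ := ((eventually_all.2 hcon).and hev).exists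
    obtain ⟨f, g, v, hv⟩ := hG.exists_isDiscountedSolution hβ01.1.le hβ01.2
    exact hβ (f, g) ⟨hβ01, v, hv⟩
  let P : (S → ℝ) →ₗ[ℝ] (S → ℝ) := LinearMap.pi fun s => mean (G.q s (f s) (g s))
  have hP : ∀ v, ‖P v‖ ≤ ‖v‖ := fun v =>
    (pi_norm_le_iff_of_nonneg (norm_nonneg _)).2 fun s => abs_mean_le _ v
  obtain ⟨φ, y, hφ, hr⟩ := exists_fixed_add_range P hP fun s => G.r s (f s) (g s)
  set w := y - P y
  have hfr : ∃ᶠ β in 𝓝[<] (1 : ℝ), ∃ v : S → ℝ, ‖v - ((1 - β)⁻¹ • φ + w)‖ ≤ (1 - β) * (2 * ‖y‖) ∧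
      G.IsDiscountedSolution β f g v :=
    hfg.mono fun β ⟨⟨hβ0, hβ1⟩, v, hv⟩ =>
      ⟨v, norm_sub_expansion_le P hP hβ0.le hβ1 hφ hr (funext hv.eq), hv⟩
  have hlow := fun s j => average_le_of_frequently_discounted_le (s := s)
    (hfr.mono fun β ⟨v, hv, hsol⟩ => ⟨v, hv, hsol.le s j⟩)
  have hupp := fun s i => average_le_of_frequently_discounted_le (φ := -φ) (w := -w)
    (C := 2 * ‖y‖) (c := -G.r s i (g s)) (p := G.q s i (g s)) (s := s)
    (hfr.mono fun β ⟨v, hv, hsol⟩ => by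
      refine ⟨-v, ?_, ?_⟩
      · rwa [show -v - ((1 - β)⁻¹ • -φ + -w) = -(v - ((1 - β)⁻¹ • φ + w)) by module, norm_neg]
      · have := hsol.ge s i
        simp only [map_neg, Pi.neg_apply]
        linarith)
  obtain ⟨M₁, hM₁⟩ := (eventually_all.2 fun s => eventually_all.2 fun j => (hlow s j).2).exists
  obtain ⟨M₂, hM₂⟩ := (eventually_all.2 fun s => eventually_all.2 fun i => (hupp s i).2).exists
  refine ⟨φ, w + M₁ • φ, w + M₂ • φ, f, g, fun s j => (hlow s j).1, hM₁, fun s i => ?_,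
    fun s i => ?_⟩
  · simpa using (hupp s i).1
  · have h := hM₂ s i
    rw [show -w + M₂ • -φ = -(w + M₂ • φ) by module, map_neg, Pi.neg_apply, Pi.neg_apply] at h
    linarith

end Discounted

/-! ### Expectations along a play -/

section Play

variable {S : Type*} {A B : S → Type*}

theorem map_fst_tripletLaw (π₁ : Strategy A B A) (π₂ : Strategy A B B) (n : ℕ)
    (h : Fin n → Triplet A B) (s : S) :
    (tripletLaw π₁ π₂ n h s).map (fun t : Triplet A B => t.1) = PMF.pure s := by
  have h1 : ∀ t : Triplet A B, (PMF.pure t).map (fun t : Triplet A B => t.1) = PMF.pure t.1 :=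
    fun t => PMF.pure_map _ t
  simp only [tripletLaw, PMF.map_bind]
  refine (congrArg _ (funext fun i => congrArg _ (funext fun j => h1 ⟨s, i, j⟩))).trans ?_
  simp only [PMF.bind_const]

theorem map_fst_nextLaw (G : StochasticGame S A B) (π₁ : Strategy A B A) (π₂ : Strategy A B B)
    (n : ℕ) (h : Fin (n + 1) → Triplet A B) :
    (G.nextLaw π₁ π₂ n h).map (fun t : Triplet A B => t.1) =
      G.q (h (Fin.last n)).1 (h (Fin.last n)).2.1 (h (Fin.last n)).2.2 := by
  simp only [nextLaw, PMF.map_bind, map_fst_tripletLaw, PMF.bind_pure]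

theorem action_eq_of_mem_support_tripletLaw_left (f : ∀ s, A s) (π₂ : Strategy A B B) (n : ℕ)
    (h : Fin n → Triplet A B) (s : S) {t : Triplet A B}
    (ht : t ∈ (tripletLaw (pureStationary f) π₂ n h s).support) : t.2.1 = f t.1 := by
  simp only [tripletLaw, pureStationary, stationary, PMF.pure_bind, PMF.mem_support_bind_iff] at ht
  obtain ⟨j, -, ht⟩ := ht
  obtain rfl := (PMF.mem_support_pure_iff _ _).1 ht
  rfl

theorem action_eq_of_mem_support_tripletLaw_right (π₁ : Strategy A B A) (g : ∀ s, B s) (n : ℕ)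
    (h : Fin n → Triplet A B) (s : S) {t : Triplet A B}
    (ht : t ∈ (tripletLaw π₁ (pureStationary g) n h s).support) : t.2.2 = g t.1 := by
  simp only [tripletLaw, pureStationary, stationary, PMF.pure_bind, PMF.mem_support_bind_iff] at ht
  obtain ⟨i, -, ht⟩ := ht
  obtain rfl := (PMF.mem_support_pure_iff _ _).1 ht
  rfl

/-- The law of the initial point under the measure of Ionescu-Tulcea. -/
theorem map_zero_trajMeasure {X : ℕ → Type*} [∀ n, MeasurableSpace (X n)] (μ₀ : Measure (X 0))
    (κ : (n : ℕ) → Kernel ((i : Finset.Iic n) → X i) (X (n + 1))) [∀ n, IsMarkovKernel (κ n)] :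
    (Kernel.trajMeasure μ₀ κ).map (fun ω => ω 0) = μ₀ := by
  have h : (Kernel.trajMeasure μ₀ κ).map (Preorder.frestrictLe 0) =
      μ₀.map (MeasurableEquiv.piUnique (fun i : Finset.Iic 0 => X i)).symm := by
    rw [Kernel.trajMeasure, Measure.map_comp _ _ (by fun_prop), Kernel.traj_map_frestrictLe,
      Kernel.partialTraj_self, Measure.id_comp]
    rfl
  have h0 : Measurable fun x : (i : Finset.Iic 0) → X i => x ⟨0, by simp⟩ := by fun_prop
  rw [show (fun ω : (n : ℕ) → X n => ω 0) = (fun x => x ⟨0, by simp⟩) ∘ Preorder.frestrictLe 0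
    from rfl, ← Measure.map_map h0 (Preorder.measurable_frestrictLe 0), h]
  exact (Measure.map_map h0 (MeasurableEquiv.measurable _)).trans Measure.map_id

theorem measurable_triplet {X : Type*} [MeasurableSpace X] (F : Triplet A B → X) : Measurable F :=
  fun _ _ => trivial

variable [Finite S] [∀ s, Finite (A s)] [∀ s, Finite (B s)]

instance (G : StochasticGame S A B) (s : S) (π₁ : Strategy A B A) (π₂ : Strategy A B B) :
    IsProbabilityMeasure (G.playMeasure s π₁ π₂) := by
  have := PMF.toMeasure.isProbabilityMeasure (tripletLaw π₁ π₂ 0 Fin.elim0 s)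
  unfold playMeasure
  infer_instance

variable (G : StochasticGame S A B) (s : S) (π₁ : Strategy A B A) (π₂ : Strategy A B B)

theorem integrable_eval (F : Triplet A B → ℝ) (n : ℕ) :
    Integrable (fun ω => F (ω n)) (G.playMeasure s π₁ π₂) := by
  obtain ⟨C, hC⟩ := (Set.finite_range fun t => ‖F t‖).bddAbove
  exact Integrable.of_bound
    ((measurable_triplet F).comp (measurable_pi_apply n)).aestronglyMeasurable C
    (ae_of_all _ fun ω => hC ⟨ω n, rfl⟩)

theorem integral_eval_zero (F : Triplet A B → ℝ) :
    ∫ ω, F (ω 0) ∂(G.playMeasure s π₁ π₂) =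
      ∫ t, F t ∂(tripletLaw π₁ π₂ 0 Fin.elim0 s).toMeasure := by
  have h := map_zero_trajMeasure (X := fun _ => Triplet A B)
    (tripletLaw π₁ π₂ 0 Fin.elim0 s).toMeasure (G.nextKernel π₁ π₂)
  rw [← h, integral_map (measurable_pi_apply 0).aemeasurable
    (measurable_triplet F).aestronglyMeasurable]
  rfl

theorem integral_eval_succ (F : Triplet A B → ℝ) (n : ℕ) :
    ∫ ω, F (ω (n + 1)) ∂(G.playMeasure s π₁ π₂) =
      ∫ ω, (∫ t, F t ∂(G.nextLaw π₁ π₂ n fun k => ω k).toMeasure) ∂(G.playMeasure s π₁ π₂) := by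
  have := PMF.toMeasure.isProbabilityMeasure (tripletLaw π₁ π₂ 0 Fin.elim0 s)
  have h := Kernel.map_frestrictLe_trajMeasure_compProd_eq_map_trajMeasure
    (X := fun _ => Triplet A B) (μ₀ := (tripletLaw π₁ π₂ 0 Fin.elim0 s).toMeasure)
    (κ := G.nextKernel π₁ π₂) (a := n)
  change (G.playMeasure s π₁ π₂).map (Preorder.frestrictLe n) ⊗ₘ G.nextKernel π₁ π₂ n =
    (G.playMeasure s π₁ π₂).map fun x => (Preorder.frestrictLe n x, x (n + 1)) at h
  have hm : Measurable fun x : ℕ → Triplet A B =>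
      ((Preorder.frestrictLe n x : (i : Finset.Iic n) → Triplet A B), x (n + 1)) := by fun_prop
  have hF : Measurable fun p : ((i : Finset.Iic n) → Triplet A B) × Triplet A B => F p.2 :=
    (measurable_triplet F).comp measurable_snd
  have hint : Integrable (fun p : ((i : Finset.Iic n) → Triplet A B) × Triplet A B => F p.2)
      ((G.playMeasure s π₁ π₂).map (Preorder.frestrictLe n) ⊗ₘ G.nextKernel π₁ π₂ n) := by
    rw [h, integrable_map_measure hF.aestronglyMeasurable hm.aemeasurable]
    exact G.integrable_eval s π₁ π₂ F (n + 1)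
  have h1 := integral_map (μ := G.playMeasure s π₁ π₂) hm.aemeasurable hF.aestronglyMeasurable
  rw [← h, Measure.integral_compProd hint,
    integral_map (Preorder.measurable_frestrictLe n).aemeasurable
      (measurable_of_countable _).aestronglyMeasurable] at h1
  exact h1.symm

/-- A function that is nonnegative on the triplets which can be chosen at any epoch has
nonnegative expectation at each epoch. -/
theorem integral_eval_nonneg {F : Triplet A B → ℝ}
    (hF : ∀ n h s, ∀ t ∈ (tripletLaw π₁ π₂ n h s).support, 0 ≤ F t) (n : ℕ) :
    0 ≤ ∫ ω, F (ω n) ∂(G.playMeasure s π₁ π₂) := by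
  have hp : ∀ p : PMF (Triplet A B), (∀ t ∈ p.support, 0 ≤ F t) →
      0 ≤ ∫ t, F t ∂p.toMeasure := fun p h => by
    refine integral_nonneg_of_ae ?_
    rw [EventuallyLE, ae_iff, PMF.toMeasure_apply_eq_zero_iff _ (by trivial)]
    exact Set.disjoint_left.2 fun t ht hn => hn (h t ht)
  cases n with
  | zero => rw [integral_eval_zero]; exact hp _ (hF _ _ _)
  | succ n =>
    rw [integral_eval_succ]
    refine integral_nonneg fun ω => hp _ fun t ht => ?_
    obtain ⟨s', -, ht'⟩ := (PMF.mem_support_bind_iff _ _ _).1 ht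
    exact hF _ _ s' t ht'

end Play

section PlayMean

variable {S : Type*} {A B : S → Type*} [Fintype S]

theorem integral_fst_eq_mean (p : PMF (Triplet A B)) (c : S → ℝ) :
    ∫ t, c t.1 ∂p.toMeasure = mean (p.map fun t => t.1) c := by
  let _ : MeasurableSpace S := ⊤
  have h : (p.map fun t => t.1).toMeasure = p.toMeasure.map fun t => t.1 :=
    Measure.ext fun E hE => by
      rw [PMF.toMeasure_map_apply _ _ _ (measurable_triplet _) hE,
        Measure.map_apply (measurable_triplet _) hE]
  rw [← integral_toMeasure_eq_mean, h, integral_map (measurable_triplet _).aemeasurable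
    (measurable_of_countable c).aestronglyMeasurable]

variable [∀ s, Finite (A s)] [∀ s, Finite (B s)]
  (G : StochasticGame S A B) (s : S) (π₁ : Strategy A B A) (π₂ : Strategy A B B)

theorem integral_state_zero (c : S → ℝ) :
    ∫ ω, c (ω 0).1 ∂(G.playMeasure s π₁ π₂) = c s := by
  rw [G.integral_eval_zero s π₁ π₂ (fun t => c t.1), integral_fst_eq_mean, map_fst_tripletLaw,
    mean_apply]
  classical
  simp [PMF.pure_apply, apply_ite]

theorem integral_state_succ (c : S → ℝ) (n : ℕ) :
    ∫ ω, c (ω (n + 1)).1 ∂(G.playMeasure s π₁ π₂) =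
      ∫ ω, mean (G.q (ω n).1 (ω n).2.1 (ω n).2.2) c ∂(G.playMeasure s π₁ π₂) := by
  rw [G.integral_eval_succ s π₁ π₂ (fun t => c t.1)]
  simp only [integral_fst_eq_mean, map_fst_nextLaw, Fin.val_last]

/-- Along every play on whose triplets `φ` is subharmonic and `H` satisfies the average reward
inequality, the expected total reward is at least `n φ s` up to a constant: `φ` is a
submartingale, and the terms in `H` telescope. -/
theorem le_integral_sum {ρ : Triplet A B → ℝ} {φ H : S → ℝ}
    (hφ : ∀ n h s, ∀ t ∈ (tripletLaw π₁ π₂ n h s).support,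
      φ t.1 ≤ mean (G.q t.1 t.2.1 t.2.2) φ)
    (hH : ∀ n h s, ∀ t ∈ (tripletLaw π₁ π₂ n h s).support,
      φ t.1 + H t.1 ≤ ρ t + mean (G.q t.1 t.2.1 t.2.2) H) (n : ℕ) :
    n * φ s - 2 * ‖H‖ ≤ ∫ ω, ∑ m ∈ Finset.range n, ρ (ω m) ∂(G.playMeasure s π₁ π₂) := by
  have hint := fun F => G.integrable_eval s π₁ π₂ F
  have hsub : ∀ m, φ s ≤ ∫ ω, φ (ω m).1 ∂(G.playMeasure s π₁ π₂) := by
    intro m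
    induction m with
    | zero => rw [integral_state_zero]
    | succ m ih =>
      have h := G.integral_eval_nonneg s π₁ π₂
        (F := fun t => mean (G.q t.1 t.2.1 t.2.2) φ - φ t.1)
        (fun n h s t ht => sub_nonneg.2 (hφ n h s t ht)) m
      rw [integral_sub (hint (fun t => mean (G.q t.1 t.2.1 t.2.2) φ) m)
        (hint (fun t => φ t.1) m), ← integral_state_succ] at h
      linarith
  have hstep : ∀ m, φ s + ∫ ω, H (ω m).1 ∂(G.playMeasure s π₁ π₂) ≤
      ∫ ω, ρ (ω m) ∂(G.playMeasure s π₁ π₂) +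
        ∫ ω, H (ω (m + 1)).1 ∂(G.playMeasure s π₁ π₂) := by
    intro m
    have h := G.integral_eval_nonneg s π₁ π₂
      (F := fun t => (ρ t + mean (G.q t.1 t.2.1 t.2.2) H) - (φ t.1 + H t.1))
      (fun n h s t ht => sub_nonneg.2 (hH n h s t ht)) m
    rw [integral_sub (hint (fun t => ρ t + mean (G.q t.1 t.2.1 t.2.2) H) m)
        (hint (fun t => φ t.1 + H t.1) m),
      integral_add (hint ρ m) (hint (fun t => mean (G.q t.1 t.2.1 t.2.2) H) m),
      integral_add (hint (fun t => φ t.1) m) (hint (fun t => H t.1) m),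
      ← integral_state_succ] at h
    linarith [hsub m]
  have htel : n * φ s + H s - ∫ ω, H (ω n).1 ∂(G.playMeasure s π₁ π₂) ≤
      ∫ ω, ∑ m ∈ Finset.range n, ρ (ω m) ∂(G.playMeasure s π₁ π₂) := by
    rw [integral_finsetSum _ fun m _ => hint ρ m]
    induction n with
    | zero => simp [integral_state_zero]
    | succ n ih =>
      rw [Finset.sum_range_succ]
      push_cast
      linarith [hstep n]
  have h1 : ∫ ω, H (ω n).1 ∂(G.playMeasure s π₁ π₂) ≤ ‖H‖ := by
    have := integral_mono (hint (fun t => H t.1) n)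
      (integrable_const (μ := G.playMeasure s π₁ π₂) ‖H‖)
      fun ω => (le_abs_self _).trans (norm_le_pi_norm H (ω n).1)
    simpa using this
  have h2 := (abs_le.1 (norm_le_pi_norm H s)).1
  linarith

end PlayMean

/-! ### Optimality -/

section Optimality

theorem tendsto_one_div_mul_affine (a b : ℝ) :
    Tendsto (fun n : ℕ => (((1 / (n : ℝ)) * (n * a + b) : ℝ) : EReal)) atTop (𝓝 (a : EReal)) := by
  refine (continuous_coe_real_ereal.tendsto a).comp ?_
  have h : Tendsto (fun n : ℕ => a + b / (n : ℝ)) atTop (𝓝 (a + 0)) :=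
    tendsto_const_nhds.add (tendsto_const_div_atTop_nhds_zero_nat b)
  rw [add_zero] at h
  refine h.congr' ?_
  filter_upwards [eventually_ne_atTop 0] with n hn
  have : (n : ℝ) ≠ 0 := Nat.cast_ne_zero.2 hn
  field_simp

variable {S : Type*} {A B : S → Type*} [Fintype S] [∀ s, Finite (A s)] [∀ s, Finite (B s)]
  {G : StochasticGame S A B}

theorem IsAverageCertificate.isOptimalPair {φ H₁ H₂ : S → ℝ} {f : ∀ s, A s} {g : ∀ s, B s}
    (hc : G.IsAverageCertificate φ H₁ H₂ f g) :
    G.IsOptimalPair φ (pureStationary f) (pureStationary g) := by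
  refine fun s => ⟨fun π₂ => ?_, fun π₁ => ?_⟩
  · rw [← (tendsto_one_div_mul_affine (φ s) (-(2 * ‖H₁‖))).liminf_eq]
    refine liminf_le_liminf (Eventually.of_forall fun n => EReal.coe_le_coe_iff.2 ?_)
    refine mul_le_mul_of_nonneg_left ?_ (by positivity)
    rw [← sub_eq_add_neg]
    refine G.le_integral_sum s _ π₂ (ρ := fun t => G.r t.1 t.2.1 t.2.2) ?_ ?_ n
    · intro n h s t ht
      rw [action_eq_of_mem_support_tripletLaw_left f π₂ n h s ht]
      exact hc.le_mean _ _
    · intro n h s t ht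
      rw [action_eq_of_mem_support_tripletLaw_left f π₂ n h s ht]
      exact hc.le_reward _ _
  · rw [← (tendsto_one_div_mul_affine (φ s) (2 * ‖H₂‖)).liminf_eq]
    refine liminf_le_liminf (Eventually.of_forall fun n => EReal.coe_le_coe_iff.2 ?_)
    refine mul_le_mul_of_nonneg_left ?_ (by positivity)
    -- The bound from above is the bound from below for the game with rewards `-r`.
    have h := G.le_integral_sum s π₁ (pureStationary g)
      (ρ := fun t => -G.r t.1 t.2.1 t.2.2) (φ := -φ) (H := -H₂) ?_ ?_ n
    · simp only [Finset.sum_neg_distrib, integral_neg, Pi.neg_apply, norm_neg] at h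
      linarith
    · intro n h s t ht
      rw [action_eq_of_mem_support_tripletLaw_right π₁ g n h s ht, map_neg, Pi.neg_apply]
      exact neg_le_neg (hc.mean_le _ _)
    · intro n h s t ht
      rw [action_eq_of_mem_support_tripletLaw_right π₁ g n h s ht, map_neg, Pi.neg_apply,
        Pi.neg_apply]
      linarith [hc.reward_le t.1 t.2.1]

end Optimality

theorem IsOptimalPair.isValueVector {S : Type*} {A B : S → Type*} [Finite S]
    [∀ s, Finite (A s)] [∀ s, Finite (B s)] {G : StochasticGame S A B} {φ : S → ℝ}
    {σ₁ : Strategy A B A} {σ₂ : Strategy A B B} (h : G.IsOptimalPair φ σ₁ σ₂) :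
    G.IsValueVector φ := by
  intro s
  have hlow : (φ s : EReal) ≤ ⨆ π₁, ⨅ π₂, G.payoff s π₁ π₂ :=
    le_iSup_of_le σ₁ (le_iInf (h s).1)
  have hupp : ⨅ π₂, ⨆ π₁, G.payoff s π₁ π₂ ≤ (φ s : EReal) :=
    iInf_le_of_le σ₂ (iSup_le (h s).2)
  have hmid := iSup_iInf_le_iInf_iSup fun π₁ π₂ => G.payoff s π₁ π₂
  exact ⟨le_antisymm (hmid.trans hupp) hlow, le_antisymm hupp (hlow.trans hmid)⟩

end StochasticGame

theorem theorem2 {S : Type*} {A : S → Type*} {B : S → Type*}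
    [Finite S] [Nonempty S] [∀ s, Finite (A s)] [∀ s, Nonempty (A s)]
    [∀ s, Finite (B s)] [∀ s, Nonempty (B s)]
    (G : StochasticGame S A B) (hG : G.PerfectInformation) :
    ∃ φ : S → ℝ, G.IsValueVector φ ∧
      ∃ (f : (s : S) → A s) (g : (s : S) → B s),
        G.IsOptimalPair φ (StochasticGame.pureStationary f) (StochasticGame.pureStationary g) := by
  cases nonempty_fintype S
  obtain ⟨φ, H₁, H₂, f, g, hc⟩ := hG.exists_isAverageCertificate
  exact ⟨φ, hc.isOptimalPair.isValueVector, f, g, hc.isOptimalPair⟩
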